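/- Let $p$ be a prime, $k$ an algebraically closed field of characteristic $p$, and $K\cong k((t))$. Consider the polynomials $$g_2(X_1,Y_1)=\frac{X_1^p+Y_1^p-(X_1+Y_1)^p}{p},$$ $$g_3(X_1,X_2,Y_1,Y_2)=\frac{X_1^{p^2}+Y_1^{p^2}-(X_1+Y_1)^{p^2}}{p^2}+\frac{X_2^p+Y_2^p-\bigl(X_2+Y_2+g_2(X_1,Y_1)\bigr)^p}{p}.$$ They have integer coefficients, and so can be evaluated in any commutative ring (the divisions are carried out in $\mathbb{Q}[X_1,X_2,Y_1,Y_2]$ before substituting). For $x_1,x_2,x_3\in K$ let $A_{x_1,x_2,x_3}$ be the quotient of the polynomial ring $K[y_1,y_2,y_3]$ by the three equations $$y_1^p-y_1=x_1,\qquad y_2^p-y_2=g_2(x_1,y_1)+x_2,\qquad y_3^p-y_3=g_3(x_1,x_2,y_1,y_2)+x_3.$$ Let $L/K$ be a Galois extension of fields with Galois group isomorphic to $\mathbb{Z}/p^3$. Then there exist $x_1,x_2,x_3\in K$ such that $L\cong A_{x_1,x_2,x_3}$ as $K$-algebras. Moreover, for any $x_1,x_2,x_3\in K$ and any $K$-algebra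 isomorphism $A_{x_1,x_2,x_3}\cong L$, if $y_1,y_2,y_3$ also denote the images in $L$ of the classes of the variables, a generator $\sigma$ of $\mathrm{Gal}(L/K)$ can be chosen so that $$\sigma(y_1)=y_1+1,\qquad \sigma(y_2)=y_2+g_2(1,y_1),\qquad \sigma(y_3)=y_3+g_3(1,0,y_1,y_2),$$ that is, $$\sigma(y_2)=y_2+\frac{y_1^p+1-(y_1+1)^p}{p},$$ $$\sigma(y_3)=y_3+\frac{y_1^{p^2}+1-(y_1+1)^{p^2}}{p^2}+\frac{y_2^p-\Bigl(y_2+\frac{y_1^p+1-(y_1+1)^p}{p}\Bigr)^p}{p},$$ with the right-hand sides again read as integer polynomials evaluated at $y_1,y_2$. -/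

import Mathlib

open MvPolynomial

/-- The polynomial `(x₁ ^ p + y₁ ^ p - (x₁ + y₁) ^ p) / p` over `ℚ`
in the variables `x₁ = X 0`, `y₁ = X 1`. -/
noncomputable def wittCarryRat₂ (p : ℕ) : MvPolynomial (Fin 2) ℚ :=
  C (1 / (p : ℚ)) * (X 0 ^ p + X 1 ^ p - (X 0 + X 1) ^ p)

/-- The polynomial
`(x₁ ^ p² + y₁ ^ p² - (x₁ + y₁) ^ p²) / p²
  + (x₂ ^ p + y₂ ^ p - (x₂ + y₂ + (x₁ ^ p + y₁ ^ p - (x₁ + y₁) ^ p) / p) ^ p) / p` over `ℚ`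
in the variables `x₁ = X 0`, `x₂ = X 1`, `y₁ = X 2`, `y₂ = X 3`. -/
noncomputable def wittCarryRat₃ (p : ℕ) : MvPolynomial (Fin 4) ℚ :=
  C (1 / (p : ℚ) ^ 2) * (X 0 ^ p ^ 2 + X 2 ^ p ^ 2 - (X 0 + X 2) ^ p ^ 2) +
    C (1 / (p : ℚ)) * (X 1 ^ p + X 3 ^ p -
      (X 1 + X 3 + C (1 / (p : ℚ)) * (X 0 ^ p + X 2 ^ p - (X 0 + X 2) ^ p)) ^ p)

theorem WittVector.ghost_add_one {p : ℕ} [Fact p.Prime] {R : Type*} [CommRing R]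
    (x y : WittVector p R) :
    (x + y).coeff 0 ^ p + p * (x + y).coeff 1 =
      (x.coeff 0 ^ p + p * x.coeff 1) + (y.coeff 0 ^ p + p * y.coeff 1) := by
  have h := (WittVector.ghostComponent (p := p) (R := R) 1).map_add x y
  simp only [WittVector.ghostComponent_apply, aeval_wittPolynomial, Finset.sum_range_succ,
    Finset.sum_range_zero] at h
  simpa using h

theorem WittVector.ghost_add_two {p : ℕ} [Fact p.Prime] {R : Type*} [CommRing R]
    (x y : WittVector p R) :
    (x + y).coeff 0 ^ p ^ 2 + p * (x + y).coeff 1 ^ p + p ^ 2 * (x + y).coeff 2 =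
      (x.coeff 0 ^ p ^ 2 + p * x.coeff 1 ^ p + p ^ 2 * x.coeff 2) +
        (y.coeff 0 ^ p ^ 2 + p * y.coeff 1 ^ p + p ^ 2 * y.coeff 2) := by
  have h := (WittVector.ghostComponent (p := p) (R := R) 2).map_add x y
  simpa [WittVector.ghostComponent_apply, aeval_wittPolynomial, Finset.sum_range_succ] using h

/-- `wittCarryRat₂ p` has integer coefficients. -/
theorem exists_map_eq_wittCarryRat₂ (p : ℕ) [Fact p.Prime] :
    ∃ F : MvPolynomial (Fin 2) ℤ, map (Int.castRingHom ℚ) F = wittCarryRat₂ p := by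
  have hp : (p : ℚ) ≠ 0 := by exact_mod_cast (Fact.out : p.Prime).ne_zero
  let x : WittVector p (MvPolynomial (Fin 2) ℤ) := WittVector.mk p fun n => if n = 0 then X 0 else 0
  let y : WittVector p (MvPolynomial (Fin 2) ℤ) := WittVector.mk p fun n => if n = 0 then X 1 else 0
  refine ⟨(x + y).coeff 1, ?_⟩
  have h1 := congrArg (map (Int.castRingHom ℚ)) (WittVector.ghost_add_one x y)
  rw [WittVector.add_coeff_zero] at h1
  simp only [x, y, WittVector.coeff_mk, map_add, map_mul, map_pow, map_X, map_natCast,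
    if_true, one_ne_zero, if_false, mul_zero, add_zero] at h1 ⊢
  have hC : (C (1 / (p : ℚ)) : MvPolynomial (Fin 2) ℚ) * (p : MvPolynomial (Fin 2) ℚ) = 1 := by
    rw [← map_natCast (C : ℚ →+* MvPolynomial (Fin 2) ℚ) p, ← C_mul, one_div_mul_cancel hp, C_1]
  rw [wittCarryRat₂]
  linear_combination (C (1 / (p : ℚ))) * h1 - (map (Int.castRingHom ℚ) ((x + y).coeff 1)) * hC

/-- `wittCarryRat₃ p` has integer coefficients. -/
theorem exists_map_eq_wittCarryRat₃ (p : ℕ) [Fact p.Prime] :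
    ∃ F : MvPolynomial (Fin 4) ℤ, map (Int.castRingHom ℚ) F = wittCarryRat₃ p := by
  have hp : (p : ℚ) ≠ 0 := by exact_mod_cast (Fact.out : p.Prime).ne_zero
  let x : WittVector p (MvPolynomial (Fin 4) ℤ) :=
    WittVector.mk p fun n => if n = 0 then X 0 else if n = 1 then X 1 else 0
  let y : WittVector p (MvPolynomial (Fin 4) ℤ) :=
    WittVector.mk p fun n => if n = 0 then X 2 else if n = 1 then X 3 else 0
  refine ⟨(x + y).coeff 2, ?_⟩
  have h1 := congrArg (map (Int.castRingHom ℚ)) (WittVector.ghost_add_one x y)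
  have h2 := congrArg (map (Int.castRingHom ℚ)) (WittVector.ghost_add_two x y)
  rw [WittVector.add_coeff_zero] at h1 h2
  have e0 : x.coeff 0 = X 0 := rfl
  have e1 : x.coeff 1 = X 1 := rfl
  have e2 : x.coeff 2 = 0 := rfl
  have f0 : y.coeff 0 = X 2 := rfl
  have f1 : y.coeff 1 = X 3 := rfl
  have f2 : y.coeff 2 = 0 := rfl
  simp only [e0, e1, e2, f0, f1, f2, map_add, map_mul, map_pow, map_X, map_natCast,
    mul_zero, add_zero] at h1 h2
  have hC : (C (1 / (p : ℚ)) : MvPolynomial (Fin 4) ℚ) * (p : MvPolynomial (Fin 4) ℚ) = 1 := by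
    rw [← map_natCast (C : ℚ →+* MvPolynomial (Fin 4) ℚ) p, ← C_mul, one_div_mul_cancel hp, C_1]
  have hC2 : (C (1 / (p : ℚ) ^ 2) : MvPolynomial (Fin 4) ℚ) = C (1 / (p : ℚ)) ^ 2 := by
    rw [← C_pow, one_div_pow]
  have hs1 : map (Int.castRingHom ℚ) ((x + y).coeff 1) =
      X 1 + X 3 + C (1 / (p : ℚ)) * (X 0 ^ p + X 2 ^ p - (X 0 + X 2) ^ p) := by
    linear_combination (C (1 / (p : ℚ))) * h1 -
      (map (Int.castRingHom ℚ) ((x + y).coeff 1) - X 1 - X 3) * hC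
  rw [wittCarryRat₃, ← hs1, hC2]
  generalize map (Int.castRingHom ℚ) ((x + y).coeff 1) = s1 at *
  generalize map (Int.castRingHom ℚ) ((x + y).coeff 2) = s2 at *
  generalize (C (1 / (p : ℚ)) : MvPolynomial (Fin 4) ℚ) = c at *
  generalize (p : MvPolynomial (Fin 4) ℚ) = q at *
  linear_combination c ^ 2 * h2 - (s2 * (c * q + 1) + c * (s1 ^ p - X 1 ^ p - X 3 ^ p)) * hC

/-- The polynomial with integer coefficients that equals `wittCarryRat₂ p` over `ℚ`. -/
noncomputable def wittCarryInt₂ (p : ℕ) [Fact p.Prime] : MvPolynomial (Fin 2) ℤ :=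
  (exists_map_eq_wittCarryRat₂ p).choose

theorem map_wittCarryInt₂ (p : ℕ) [Fact p.Prime] :
    map (Int.castRingHom ℚ) (wittCarryInt₂ p) = wittCarryRat₂ p :=
  (exists_map_eq_wittCarryRat₂ p).choose_spec

/-- The polynomial with integer coefficients that equals `wittCarryRat₃ p` over `ℚ`. -/
noncomputable def wittCarryInt₃ (p : ℕ) [Fact p.Prime] : MvPolynomial (Fin 4) ℤ :=
  (exists_map_eq_wittCarryRat₃ p).choose

theorem map_wittCarryInt₃ (p : ℕ) [Fact p.Prime] :
    map (Int.castRingHom ℚ) (wittCarryInt₃ p) = wittCarryRat₃ p :=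
  (exists_map_eq_wittCarryRat₃ p).choose_spec

/-- The value of `(x₁ ^ p + y₁ ^ p - (x₁ + y₁) ^ p) / p` in a commutative ring: the division is
carried out in the polynomial ring, before the elements are substituted. -/
noncomputable def wittCarry₂ (p : ℕ) [Fact p.Prime] {R : Type*} [CommRing R] (x₁ y₁ : R) : R :=
  aeval ![x₁, y₁] (wittCarryInt₂ p)

/-- The value of
`(x₁ ^ p² + y₁ ^ p² - (x₁ + y₁) ^ p²) / p²
  + (x₂ ^ p + y₂ ^ p - (x₂ + y₂ + (x₁ ^ p + y₁ ^ p - (x₁ + y₁) ^ p) / p) ^ p) / p`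
in a commutative ring: the divisions are carried out in the polynomial ring, before the elements
are substituted. -/
noncomputable def wittCarry₃ (p : ℕ) [Fact p.Prime] {R : Type*} [CommRing R]
    (x₁ x₂ y₁ y₂ : R) : R :=
  aeval ![x₁, x₂, y₁, y₂] (wittCarryInt₃ p)

/-- The ideal of the three equations
`y₁ ^ p - y₁ = x₁`, `y₂ ^ p - y₂ = wittCarry₂ p x₁ y₁ + x₂`,
`y₃ ^ p - y₃ = wittCarry₃ p x₁ x₂ y₁ y₂ + x₃`
in the polynomial ring `K[y₁, y₂, y₃]`, where `y₁ = X 0`, `y₂ = X 1`, `y₃ = X 2`. -/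
noncomputable def wittEquationIdeal (p : ℕ) [Fact p.Prime] {K : Type*} [CommRing K]
    (x₁ x₂ x₃ : K) : Ideal (MvPolynomial (Fin 3) K) :=
  Ideal.span
    {X 0 ^ p - X 0 - C x₁,
     X 1 ^ p - X 1 - (wittCarry₂ p (C x₁) (X 0) + C x₂),
     X 2 ^ p - X 2 - (wittCarry₃ p (C x₁) (C x₂) (X 0) (X 1) + C x₃)}

/-- The `K`-algebra `K[y₁, y₂, y₃]` modulo the three equations. -/
abbrev WittEquationAlgebra (p : ℕ) [Fact p.Prime] {K : Type*} [CommRing K] (x₁ x₂ x₃ : K) :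
    Type _ :=
  MvPolynomial (Fin 3) K ⧸ wittEquationIdeal p x₁ x₂ x₃

/-- The classes of `y₁`, `y₂`, `y₃` (indexed by `0`, `1`, `2`) in this algebra. -/
noncomputable def WittEquationAlgebra.gen (p : ℕ) [Fact p.Prime] {K : Type*} [CommRing K]
    (x₁ x₂ x₃ : K) (i : Fin 3) : WittEquationAlgebra p x₁ x₂ x₃ :=
  Ideal.Quotient.mk (wittEquationIdeal p x₁ x₂ x₃) (X i)

/-!
This is Artin–Schreier–Witt theory in length three. The carries `wittCarry₂` and `wittCarry₃` are the
correction terms in the addition of `p`-typical Witt vectors (`WittVector.add_coeff_one_and_two`), so in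
characteristic `p` the three equations say that `frobenius y = x + y` holds for Witt vectors up to
their first three coefficients (`WittVector.truncate_frobenius_eq_iff`), and the formulas for `σ` say
that `σ y = y + 1`. Witt vectors of infinite length are used throughout, and compared after
`WittVector.truncate`.

For the existence, let `σ` generate the Galois group, of order `p ^ 3`. The Teichmüller lift of an
element of nonzero trace has a unit as its trace in `W(L)`, and the explicit formula of the additive
Hilbert 90 gives `y` with `σ y = y + 1` up to a multiple of `p ^ 3`, which vanishes in length three
(`WittVector.exists_truncate_map_eq_add_one`). Then `x = frobenius y - y` has its first coefficients
in `K`, and `y` defines an algebra homomorphism to `L`. It is surjective, because `σ ^ m y = y + m` shows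
that only the identity fixes the coefficients of `y` (`WittVector.adjoin_coeff_eq_top`). It is bijective,
because the algebra has dimension at most `p ^ 3`
(`WittEquationAlgebra.finiteDimensional_and_finrank_le`).

For the second part, `y + 1` solves the same equation as `y`, which gives an automorphism `σ` with
`σ y = y + 1` (`WittEquationAlgebra.exists_algEquiv_apply_gen`). As `σ ^ m y = y + m`, its order is a
multiple of `p ^ 3`, and it generates the Galois group.
-/

/-! ### The carry polynomials and the addition of Witt vectors -/

theorem map_wittCarry₂ (p : ℕ) [Fact p.Prime] {R S F : Type*} [CommRing R] [CommRing S]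
    [FunLike F R S] [RingHomClass F R S] (f : F) (a b : R) :
    f (wittCarry₂ p a b) = wittCarry₂ p (f a) (f b) := by
  have h := DFunLike.congr_fun (MvPolynomial.comp_aeval ![a, b]
    (RingHom.toIntAlgHom (f : R →+* S))) (wittCarryInt₂ p)
  have e : (fun i => (RingHom.toIntAlgHom (f : R →+* S)) (![a, b] i)) = ![f a, f b] := by
    ext i; fin_cases i <;> rfl
  rw [e] at h
  exact h

theorem map_wittCarry₃ (p : ℕ) [Fact p.Prime] {R S F : Type*} [CommRing R] [CommRing S]
    [FunLike F R S] [RingHomClass F R S] (f : F) (a b c d : R) :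
    f (wittCarry₃ p a b c d) = wittCarry₃ p (f a) (f b) (f c) (f d) := by
  have h := DFunLike.congr_fun (MvPolynomial.comp_aeval ![a, b, c, d]
    (RingHom.toIntAlgHom (f : R →+* S))) (wittCarryInt₃ p)
  have e : (fun i => (RingHom.toIntAlgHom (f : R →+* S)) (![a, b, c, d] i)) =
      ![f a, f b, f c, f d] := by
    ext i; fin_cases i <;> rfl
  rw [e] at h
  exact h

theorem natCast_mul_wittCarryInt₂ (p : ℕ) [Fact p.Prime] :
    (p : MvPolynomial (Fin 2) ℤ) * wittCarryInt₂ p = X 0 ^ p + X 1 ^ p - (X 0 + X 1) ^ p := by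
  have hp : (p : ℚ) ≠ 0 := by exact_mod_cast (Fact.out : p.Prime).ne_zero
  apply map_injective (Int.castRingHom ℚ) Int.cast_injective
  have hC : (p : MvPolynomial (Fin 2) ℚ) * C (1 / (p : ℚ)) = 1 := by
    rw [← map_natCast (C : ℚ →+* MvPolynomial (Fin 2) ℚ) p, ← C_mul, mul_one_div_cancel hp, C_1]
  simp only [map_mul, map_natCast, map_wittCarryInt₂, wittCarryRat₂, map_add, map_sub, map_pow,
    map_X]
  linear_combination (X 0 ^ p + X 1 ^ p - (X 0 + X 1) ^ p) * hC

theorem natCast_mul_wittCarry₂ (p : ℕ) [Fact p.Prime] {R : Type*} [CommRing R] (a b : R) :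
    (p : R) * wittCarry₂ p a b = a ^ p + b ^ p - (a + b) ^ p := by
  simpa [wittCarry₂] using congrArg (aeval ![a, b]) (natCast_mul_wittCarryInt₂ p)

theorem natCast_sq_mul_wittCarryInt₃ (p : ℕ) [Fact p.Prime] :
    (p : MvPolynomial (Fin 4) ℤ) ^ 2 * wittCarryInt₃ p =
      X 0 ^ p ^ 2 + X 2 ^ p ^ 2 - (X 0 + X 2) ^ p ^ 2 +
        (p : MvPolynomial (Fin 4) ℤ) *
          (X 1 ^ p + X 3 ^ p - (X 1 + X 3 + wittCarry₂ p (X 0) (X 2)) ^ p) := by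
  have hp : (p : ℚ) ≠ 0 := by exact_mod_cast (Fact.out : p.Prime).ne_zero
  apply map_injective (Int.castRingHom ℚ) Int.cast_injective
  have hC : (p : MvPolynomial (Fin 4) ℚ) * C (1 / (p : ℚ)) = 1 := by
    rw [← map_natCast (C : ℚ →+* MvPolynomial (Fin 4) ℚ) p, ← C_mul, mul_one_div_cancel hp, C_1]
  have hC2 : (C (1 / (p : ℚ) ^ 2) : MvPolynomial (Fin 4) ℚ) = C (1 / (p : ℚ)) ^ 2 := by
    rw [← C_pow, one_div_pow]
  have hg : (wittCarry₂ p (X 0) (X 2) : MvPolynomial (Fin 4) ℚ) =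
      C (1 / (p : ℚ)) * (X 0 ^ p + X 2 ^ p - (X 0 + X 2) ^ p) := by
    linear_combination (- wittCarry₂ p (X 0) (X 2)) * hC +
      C (1 / (p : ℚ)) * natCast_mul_wittCarry₂ p (X 0 : MvPolynomial (Fin 4) ℚ) (X 2)
  simp only [map_mul, map_natCast, map_wittCarryInt₃, wittCarryRat₃, map_add, map_sub, map_pow,
    map_X, map_wittCarry₂, hg, hC2]
  generalize (X 1 + X 3 + C (1 / (p : ℚ)) * (X 0 ^ p + X 2 ^ p - (X 0 + X 2) ^ p) :
    MvPolynomial (Fin 4) ℚ) ^ p = s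
  linear_combination ((X 0 ^ p ^ 2 + X 2 ^ p ^ 2 - (X 0 + X 2) ^ p ^ 2) *
    (p * C (1 / (p : ℚ)) + 1) + p * (X 1 ^ p + X 3 ^ p - s)) * hC

theorem natCast_sq_mul_wittCarry₃ (p : ℕ) [Fact p.Prime] {R : Type*} [CommRing R] (a b c d : R) :
    (p : R) ^ 2 * wittCarry₃ p a b c d = a ^ p ^ 2 + c ^ p ^ 2 - (a + c) ^ p ^ 2 +
      p * (b ^ p + d ^ p - (b + d + wittCarry₂ p a c) ^ p) := by
  simpa [wittCarry₃, map_wittCarry₂] using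
    congrArg (aeval ![a, b, c, d]) (natCast_sq_mul_wittCarryInt₃ p)

namespace WittVector

variable {p : ℕ} [Fact p.Prime] {R : Type*} [CommRing R]

/-- Over a domain of characteristic zero the addition formulas follow from the ghost components by
cancelling powers of `p`. -/
theorem add_coeff_one_and_two_of_charZero [IsDomain R] [CharZero R] (x y : WittVector p R) :
    (x + y).coeff 1 = x.coeff 1 + y.coeff 1 + wittCarry₂ p (x.coeff 0) (y.coeff 0) ∧
    (x + y).coeff 2 = x.coeff 2 + y.coeff 2 +
      wittCarry₃ p (x.coeff 0) (x.coeff 1) (y.coeff 0) (y.coeff 1) := by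
  have hp : (p : R) ≠ 0 := by exact_mod_cast (Fact.out : p.Prime).ne_zero
  have h1 := ghost_add_one x y
  have h2 := ghost_add_two x y
  rw [add_coeff_zero] at h1 h2
  have e1 : (x + y).coeff 1 = x.coeff 1 + y.coeff 1 + wittCarry₂ p (x.coeff 0) (y.coeff 0) := by
    apply mul_left_cancel₀ hp
    linear_combination h1 - natCast_mul_wittCarry₂ p (x.coeff 0) (y.coeff 0)
  refine ⟨e1, mul_left_cancel₀ (pow_ne_zero 2 hp) ?_⟩
  have h3 := natCast_sq_mul_wittCarry₃ p (x.coeff 0) (x.coeff 1) (y.coeff 0) (y.coeff 1)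
  rw [← e1] at h3
  linear_combination h2 - h3

/-- Any two Witt vectors are the images of the generic pair over a polynomial ring over `ℤ`. -/
theorem exists_map_eq_of_charZero (x y : WittVector p R) :
    ∃ (f : MvPolynomial (ℕ ⊕ ℕ) ℤ →+* R) (x' y' : WittVector p (MvPolynomial (ℕ ⊕ ℕ) ℤ)),
      map f x' = x ∧ map f y' = y := by
  refine ⟨(aeval (Sum.elim x.coeff y.coeff)).toRingHom, mk p fun n => X (.inl n),
    mk p fun n => X (.inr n), ?_, ?_⟩ <;>
  · ext n
    simp [map_coeff]

/-- The polynomials `wittCarry₂` and `wittCarry₃` are the carries in the addition of Witt vectors. -/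
theorem add_coeff_one_and_two (x y : WittVector p R) :
    (x + y).coeff 1 = x.coeff 1 + y.coeff 1 + wittCarry₂ p (x.coeff 0) (y.coeff 0) ∧
    (x + y).coeff 2 = x.coeff 2 + y.coeff 2 +
      wittCarry₃ p (x.coeff 0) (x.coeff 1) (y.coeff 0) (y.coeff 1) := by
  obtain ⟨f, x, y, rfl, rfl⟩ := exists_map_eq_of_charZero x y
  have h := add_coeff_one_and_two_of_charZero x y
  rw [← map_add]
  rw [map_coeff f (x + y), map_coeff f (x + y), h.1, h.2]
  simp only [map_coeff, map_add, map_wittCarry₂, map_wittCarry₃, and_self]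

/-! ### Truncated Witt vectors in characteristic `p` -/

theorem truncate_eq_iff {n : ℕ} {x y : WittVector p R} :
    truncate n x = truncate n y ↔ ∀ i < n, x.coeff i = y.coeff i := by
  rw [TruncatedWittVector.ext_iff]
  simp only [coeff_truncate, Fin.forall_iff]

theorem truncate_three_eq_iff {x y : WittVector p R} :
    truncate 3 x = truncate 3 y ↔
      x.coeff 0 = y.coeff 0 ∧ x.coeff 1 = y.coeff 1 ∧ x.coeff 2 = y.coeff 2 := by
  rw [truncate_eq_iff]
  constructor
  · exact fun h => ⟨h 0 (by norm_num), h 1 (by norm_num), h 2 (by norm_num)⟩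
  · rintro ⟨h0, h1, h2⟩ i hi
    interval_cases i <;> assumption

theorem truncate_natCast_pow_mul [CharP R p] (n : ℕ) (x : WittVector p R) :
    truncate n ((p : WittVector p R) ^ n * x) = 0 := by
  rw [← map_zero (truncate n), truncate_eq_iff]
  intro i hi
  rw [mul_comm, mul_pow_charP_coeff_zero x hi, zero_coeff]

theorem truncate_frobenius_congr [CharP R p] {n : ℕ} {x y : WittVector p R}
    (h : truncate n x = truncate n y) : truncate n (frobenius x) = truncate n (frobenius y) := by
  rw [truncate_eq_iff] at h ⊢
  intro i hi
  rw [coeff_frobenius_charP, coeff_frobenius_charP, h i hi]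

theorem truncate_map_congr {S : Type*} [CommRing S] (f : R →+* S) {n : ℕ} {x y : WittVector p R}
    (h : truncate n x = truncate n y) : truncate n (map f x) = truncate n (map f y) := by
  rw [truncate_eq_iff] at h ⊢
  intro i hi
  rw [map_coeff, map_coeff, h i hi]

/-- In characteristic `p`, the three equations that define `WittEquationAlgebra` say that
`frobenius y = x + y` in length three. -/
theorem truncate_frobenius_eq_iff [CharP R p] {x y : WittVector p R} :
    truncate 3 (frobenius y) = truncate 3 (x + y) ↔
      y.coeff 0 ^ p - y.coeff 0 = x.coeff 0 ∧
      y.coeff 1 ^ p - y.coeff 1 = wittCarry₂ p (x.coeff 0) (y.coeff 0) + x.coeff 1 ∧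
      y.coeff 2 ^ p - y.coeff 2 =
        wittCarry₃ p (x.coeff 0) (x.coeff 1) (y.coeff 0) (y.coeff 1) + x.coeff 2 := by
  simp only [truncate_three_eq_iff, coeff_frobenius_charP, add_coeff_zero, add_coeff_one_and_two]
  refine and_congr ?_ (and_congr ?_ ?_) <;>
  · constructor <;> intro h <;> linear_combination h

/-- The ring of truncated Witt vectors of length `n` has characteristic `p ^ n`. -/
theorem pow_dvd_of_truncate_natCast_eq_zero [CharP R p] [Nontrivial R] {n m : ℕ}
    (h : truncate n (m : WittVector p R) = 0) : p ^ n ∣ m := by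
  have hn : truncate n ((p ^ n : ℕ) : WittVector p R) = 0 := by
    simpa using truncate_natCast_pow_mul n (1 : WittVector p R)
  rw [map_natCast, ← nsmul_one] at h hn
  obtain ⟨i, hi, ho⟩ := (Nat.dvd_prime_pow Fact.out).1 (addOrderOf_dvd_of_nsmul_eq_zero hn)
  rcases hi.eq_or_lt with rfl | hi
  · exact ho ▸ addOrderOf_dvd_of_nsmul_eq_zero h
  · have h0 : truncate n ((p : WittVector p R) ^ i) = truncate n 0 := by
      have := addOrderOf_nsmul_eq_zero (1 : TruncatedWittVector p n R)
      rw [ho, nsmul_one] at this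
      rw [map_zero, ← this, map_pow, map_natCast, Nat.cast_pow]
    have := truncate_eq_iff.1 h0 i hi
    rw [coeff_p_pow, zero_coeff] at this
    exact absurd this one_ne_zero

end WittVector

/-! ### The additive Hilbert 90 for a constant -/

/-- If `φ` acts with period `n` on `a` and the trace `u` of `a` is a unit, then `1` is of the form
`φ y - y` up to a multiple of `n`. With `v = ∑ i < n, i • φ^[i] a` one has
`φ v = v + n • a - u`, so `y = - u⁻¹ * v` works. -/
theorem exists_map_eq_add_one {W : Type*} [CommRing W] (φ : W →+* W) (n : ℕ) (a : W)
    (ha : φ^[n] a = a) (hu : IsUnit (∑ i ∈ Finset.range n, φ^[i] a)) :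
    ∃ y c : W, φ y = y + 1 + n * c := by
  obtain ⟨u, hu⟩ := hu
  set v := ∑ i ∈ Finset.range n, (i : W) * φ^[i] a with hv
  have hφu : φ u = u := by
    have h := (Finset.sum_range_succ' (fun i => φ^[i] a) n).symm.trans
      (Finset.sum_range_succ (fun i => φ^[i] a) n)
    rw [ha, Function.iterate_zero_apply] at h
    rw [hu, map_sum]
    simpa only [Function.iterate_succ_apply'] using add_right_cancel h
  have hφv : φ v = v + n * a - u := by
    have h := (Finset.sum_range_succ' (fun i => (i : W) * φ^[i] a) n).symm.trans
      (Finset.sum_range_succ (fun i => (i : W) * φ^[i] a) n)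
    have hs : ∑ i ∈ Finset.range n, φ^[i + 1] a = u := by
      simp only [Function.iterate_succ_apply', ← map_sum, ← hu, hφu]
    simp only [Nat.cast_zero, zero_mul, add_zero, Nat.cast_add, Nat.cast_one, add_mul, one_mul,
      Finset.sum_add_distrib, hs, ha] at h
    simp only [hv, map_sum, map_mul, map_natCast, ← Function.iterate_succ_apply' φ]
    linear_combination h
  have hinv : φ (↑u⁻¹ : W) = ↑u⁻¹ := by
    have h1 : φ (↑u⁻¹ : W) * u = 1 := by
      conv_lhs => rw [← hφu, ← map_mul, Units.inv_mul, map_one]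
    linear_combination (↑u⁻¹ : W) * h1 - φ (↑u⁻¹ : W) * u.mul_inv
  refine ⟨-(↑u⁻¹ * v), -(↑u⁻¹ * a), ?_⟩
  rw [map_neg, map_mul, hinv, hφv]
  linear_combination u.inv_mul

/-! ### The dimension of the algebra of the equations -/

section Span

variable {K A : Type*} [Field K] [CommRing A] [Algebra K A]

/-- Adjoining a root of an Artin–Schreier equation multiplies the dimension by at most `p`: if `M` is
stable under `S` and `y ^ p - y ∈ S`, then `N = ∑ i < p, y ^ i * M` is stable under `S` and `y`. -/
theorem exists_submodule_finrank_le_mul (S : Subalgebra K A) (M : Submodule K A)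
    [FiniteDimensional K M] (hM : ∀ s ∈ S, ∀ m ∈ M, s * m ∈ M) {p : ℕ} (hp : 1 < p) (y : A)
    (hy : y ^ p - y ∈ S) :
    ∃ N : Submodule K A, FiniteDimensional K N ∧
      Module.finrank K N ≤ p * Module.finrank K M ∧ M ≤ N ∧
      ∀ s ∈ S ⊔ Algebra.adjoin K {y}, ∀ m ∈ N, s * m ∈ N := by
  let f : (Fin p → M) →ₗ[K] A :=
    ∑ i : Fin p, (LinearMap.mulLeft K (y ^ (i : ℕ))) ∘ₗ M.subtype ∘ₗ LinearMap.proj i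
  have hf (v : Fin p → M) : f v = ∑ i : Fin p, y ^ (i : ℕ) * (v i : A) := by
    simp [f]
  have hmem (i : ℕ) (hi : i < p) (m : A) (hm : m ∈ M) : y ^ i * m ∈ LinearMap.range f := by
    refine ⟨Pi.single ⟨i, hi⟩ ⟨m, hm⟩, ?_⟩
    rw [hf, Finset.sum_eq_single ⟨i, hi⟩]
    · simp
    · intro j _ hj
      simp [Pi.single_eq_of_ne hj]
    · simp
  have hS : ∀ s ∈ S, ∀ m ∈ LinearMap.range f, s * m ∈ LinearMap.range f := by
    rintro s hs _ ⟨v, rfl⟩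
    rw [hf, Finset.mul_sum]
    refine Submodule.sum_mem _ fun i _ => ?_
    rw [mul_left_comm]
    exact hmem i i.2 _ (hM s hs _ (v i).2)
  have hY : ∀ m ∈ LinearMap.range f, y * m ∈ LinearMap.range f := by
    rintro _ ⟨v, rfl⟩
    rw [hf, Finset.mul_sum]
    refine Submodule.sum_mem _ fun i _ => ?_
    rw [← mul_assoc, ← pow_succ']
    rcases (Nat.succ_le_of_lt i.2).lt_or_eq with hi | hi
    · exact hmem _ hi _ (v i).2
    · -- `y ^ p = (y ^ p - y) + y`
      have : y ^ ((i : ℕ) + 1) * (v i : A) =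
          y ^ 0 * ((y ^ p - y) * (v i : A)) + y ^ 1 * (v i : A) := by
        rw [show (i : ℕ) + 1 = p from hi]; ring
      rw [this]
      exact Submodule.add_mem _ (hmem 0 (by omega) _ (hM _ hy _ (v i).2)) (hmem 1 hp _ (v i).2)
  refine ⟨LinearMap.range f, inferInstance, ?_, ?_, ?_⟩
  · refine (LinearMap.finrank_range_le f).trans ?_
    rw [Module.finrank_pi_fintype]
    simp
  · intro m hm
    simpa using hmem 0 (by omega) m hm
  · -- the elements that map the range into itself form a subalgebra
    let T : Subalgebra K A :=
      { carrier := {s | ∀ m ∈ LinearMap.range f, s * m ∈ LinearMap.range f}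
        mul_mem' := fun {a b} ha hb m hm => by rw [mul_assoc]; exact ha _ (hb _ hm)
        add_mem' := fun {a b} ha hb m hm => by
          rw [add_mul]; exact Submodule.add_mem _ (ha _ hm) (hb _ hm)
        algebraMap_mem' := fun r m hm => by
          rw [← Algebra.smul_def]; exact Submodule.smul_mem _ r hm }
    have hT : S ⊔ Algebra.adjoin K {y} ≤ T :=
      sup_le hS (Algebra.adjoin_le (Set.singleton_subset_iff.2 hY))
    exact fun s hs => hT hs

end Span

namespace WittEquationAlgebra

variable (p : ℕ) [Fact p.Prime] {K : Type*}

section CommRing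

variable [CommRing K] (x₁ x₂ x₃ : K)

theorem gen_zero_pow_sub : gen p x₁ x₂ x₃ 0 ^ p - gen p x₁ x₂ x₃ 0 = algebraMap K _ x₁ := by
  rw [← sub_eq_zero]
  exact Ideal.Quotient.eq_zero_iff_mem.2 (Ideal.subset_span (Or.inl rfl))

theorem gen_one_pow_sub : gen p x₁ x₂ x₃ 1 ^ p - gen p x₁ x₂ x₃ 1 =
    wittCarry₂ p (algebraMap K _ x₁) (gen p x₁ x₂ x₃ 0) + algebraMap K _ x₂ := by
  have h : Ideal.Quotient.mk (wittEquationIdeal p x₁ x₂ x₃)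
      (X 1 ^ p - X 1 - (wittCarry₂ p (C x₁) (X 0) + C x₂)) = 0 :=
    Ideal.Quotient.eq_zero_iff_mem.2 (Ideal.subset_span (Or.inr (Or.inl rfl)))
  rw [map_sub, map_add, map_wittCarry₂, map_sub, map_pow] at h
  exact sub_eq_zero.1 h

theorem gen_two_pow_sub : gen p x₁ x₂ x₃ 2 ^ p - gen p x₁ x₂ x₃ 2 =
    wittCarry₃ p (algebraMap K _ x₁) (algebraMap K _ x₂) (gen p x₁ x₂ x₃ 0) (gen p x₁ x₂ x₃ 1) +
      algebraMap K _ x₃ := by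
  have h : Ideal.Quotient.mk (wittEquationIdeal p x₁ x₂ x₃)
      (X 2 ^ p - X 2 - (wittCarry₃ p (C x₁) (C x₂) (X 0) (X 1) + C x₃)) = 0 :=
    Ideal.Quotient.eq_zero_iff_mem.2 (Ideal.subset_span (Or.inr (Or.inr rfl)))
  rw [map_sub, map_add, map_wittCarry₃, map_sub, map_pow] at h
  exact sub_eq_zero.1 h

theorem adjoin_range_gen : Algebra.adjoin K (Set.range (gen p x₁ x₂ x₃)) = ⊤ := by
  have h := congrArg (Subalgebra.map (Ideal.Quotient.mkₐ K (wittEquationIdeal p x₁ x₂ x₃)))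
    (MvPolynomial.adjoin_range_X (R := K) (σ := Fin 3))
  rw [AlgHom.map_adjoin, Algebra.map_top, (AlgHom.range_eq_top _).2
    (Ideal.Quotient.mkₐ_surjective K _), ← Set.range_comp] at h
  exact h

end CommRing

theorem wittCarry₂_mem {A : Type*} [CommRing K] [CommRing A] [Algebra K A]
    (S : Subalgebra K A) {a b : A}
    (ha : a ∈ S) (hb : b ∈ S) : wittCarry₂ p a b ∈ S := by
  have := map_wittCarry₂ p S.val ⟨a, ha⟩ ⟨b, hb⟩
  exact this ▸ (wittCarry₂ p (⟨a, ha⟩ : S) ⟨b, hb⟩).2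

theorem wittCarry₃_mem {A : Type*} [CommRing K] [CommRing A] [Algebra K A]
    (S : Subalgebra K A) {a b c d : A}
    (ha : a ∈ S) (hb : b ∈ S) (hc : c ∈ S) (hd : d ∈ S) : wittCarry₃ p a b c d ∈ S := by
  have := map_wittCarry₃ p S.val ⟨a, ha⟩ ⟨b, hb⟩ ⟨c, hc⟩ ⟨d, hd⟩
  exact this ▸ (wittCarry₃ p (⟨a, ha⟩ : S) ⟨b, hb⟩ ⟨c, hc⟩ ⟨d, hd⟩).2

theorem finiteDimensional_and_finrank_le [Field K] (x₁ x₂ x₃ : K) :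
    FiniteDimensional K (WittEquationAlgebra p x₁ x₂ x₃) ∧
      Module.finrank K (WittEquationAlgebra p x₁ x₂ x₃) ≤ p ^ 3 := by
  have hp : 1 < p := (Fact.out : p.Prime).one_lt
  let A := WittEquationAlgebra p x₁ x₂ x₃
  let g : Fin 3 → A := gen p x₁ x₂ x₃
  let M₀ : Submodule K A := LinearMap.range (Algebra.linearMap K A)
  have h₀ : ∀ s ∈ (⊥ : Subalgebra K A), ∀ m ∈ M₀, s * m ∈ M₀ := by
    rintro s hs _ ⟨b, rfl⟩
    obtain ⟨a, rfl⟩ := Algebra.mem_bot.1 hs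
    exact ⟨a * b, by simp⟩
  have hr₀ : Module.finrank K M₀ ≤ 1 :=
    (LinearMap.finrank_range_le _).trans (Module.finrank_self K).le
  obtain ⟨M₁, _, hr₁, hle₁, h₁⟩ := exists_submodule_finrank_le_mul ⊥ M₀ h₀ hp (g 0)
    (by rw [gen_zero_pow_sub]; exact Subalgebra.algebraMap_mem _ _)
  set S₁ : Subalgebra K A := ⊥ ⊔ Algebra.adjoin K {g 0} with hS₁
  have hg0 : g 0 ∈ S₁ := le_sup_right (α := Subalgebra K A) (Algebra.self_mem_adjoin_singleton K _)
  obtain ⟨M₂, _, hr₂, hle₂, h₂⟩ := exists_submodule_finrank_le_mul S₁ M₁ h₁ hp (g 1) (by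
    rw [gen_one_pow_sub]
    exact add_mem (wittCarry₂_mem p _ (Subalgebra.algebraMap_mem _ _) hg0)
      (Subalgebra.algebraMap_mem _ _))
  set S₂ : Subalgebra K A := S₁ ⊔ Algebra.adjoin K {g 1} with hS₂
  have hg0' : g 0 ∈ S₂ := le_sup_left (α := Subalgebra K A) hg0
  have hg1 : g 1 ∈ S₂ := le_sup_right (α := Subalgebra K A) (Algebra.self_mem_adjoin_singleton K _)
  obtain ⟨M₃, _, hr₃, hle₃, h₃⟩ := exists_submodule_finrank_le_mul S₂ M₂ h₂ hp (g 2) (by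
    rw [gen_two_pow_sub]
    exact add_mem (wittCarry₃_mem p _ (Subalgebra.algebraMap_mem _ _)
      (Subalgebra.algebraMap_mem _ _) hg0' hg1) (Subalgebra.algebraMap_mem _ _))
  set S₃ : Subalgebra K A := S₂ ⊔ Algebra.adjoin K {g 2} with hS₃
  have hS : S₃ = ⊤ := by
    rw [eq_top_iff, ← adjoin_range_gen]
    refine Algebra.adjoin_le ?_
    rintro _ ⟨i, rfl⟩
    fin_cases i
    · exact le_sup_left (α := Subalgebra K A) hg0'
    · exact le_sup_left (α := Subalgebra K A) hg1
    · exact le_sup_right (α := Subalgebra K A) (Algebra.self_mem_adjoin_singleton K _)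
  have hM : M₃ = ⊤ := by
    rw [eq_top_iff]
    intro a _
    have h1 : (1 : A) ∈ M₃ := hle₃ (hle₂ (hle₁ ⟨1, by simp⟩))
    simpa using h₃ a (hS ▸ Algebra.mem_top) 1 h1
  subst hM
  refine ⟨Module.Finite.equiv Submodule.topEquiv, ?_⟩
  calc Module.finrank K A = Module.finrank K (⊤ : Submodule K A) := (finrank_top K A).symm
    _ ≤ p * Module.finrank K M₂ := hr₃
    _ ≤ p * (p * (p * 1)) := by gcongr; exact hr₂.trans (by gcongr; exact hr₁.trans (by gcongr))
    _ = p ^ 3 := by ring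

/-- The universal property of the algebra of the equations. -/
theorem exists_algHom [CommRing K] {x₁ x₂ x₃ : K} {B : Type*} [CommRing B] [Algebra K B]
    (y : Fin 3 → B)
    (h₁ : y 0 ^ p - y 0 = algebraMap K B x₁)
    (h₂ : y 1 ^ p - y 1 = wittCarry₂ p (algebraMap K B x₁) (y 0) + algebraMap K B x₂)
    (h₃ : y 2 ^ p - y 2 = wittCarry₃ p (algebraMap K B x₁) (algebraMap K B x₂) (y 0) (y 1) +
      algebraMap K B x₃) :
    ∃ f : WittEquationAlgebra p x₁ x₂ x₃ →ₐ[K] B, ∀ i, f (gen p x₁ x₂ x₃ i) = y i := by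
  refine ⟨Ideal.Quotient.liftₐ _ (aeval y) fun a ha => ?_, fun i => aeval_X y i⟩
  rw [← RingHom.mem_ker]
  refine (Ideal.span_le (I := RingHom.ker (aeval y : MvPolynomial (Fin 3) K →ₐ[K] B))).2 ?_ ha
  have hC (c : K) : aeval y (C c) = algebraMap K B c := aeval_C y c
  rintro _ (rfl | rfl | rfl) <;> rw [SetLike.mem_coe, RingHom.mem_ker]
  · simp [h₁]
  · simp [map_wittCarry₂, hC, h₂]
  · simp [map_wittCarry₃, hC, h₃]

end WittEquationAlgebra

/-! ### Galois action on Witt vectors -/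

namespace WittVector

variable {p : ℕ} [Fact p.Prime] {K L : Type*} [Field K] [Field L] [Algebra K L]

theorem map_frobenius_of_charP {R S : Type*} [CommRing R] [CommRing S] [CharP R p] [CharP S p]
    (f : R →+* S) (x : WittVector p R) : map f (frobenius x) = frobenius (map f x) := by
  ext n
  simp only [map_coeff, coeff_frobenius_charP, map_pow]

theorem truncate_map_pow {n : ℕ} {y : WittVector p L} {σ : L ≃ₐ[K] L}
    (h : truncate n (map (σ : L →+* L) y) = truncate n (y + 1)) (m : ℕ) :
    truncate n (map ((σ ^ m : L ≃ₐ[K] L) : L →+* L) y) = truncate n (y + (m : WittVector p L)) := by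
  induction m with
  | zero =>
    congr 1
    ext i
    simp [map_coeff]
  | succ m ih =>
    have e : map ((σ ^ (m + 1) : L ≃ₐ[K] L) : L →+* L) y =
        map (σ : L →+* L) (map ((σ ^ m : L ≃ₐ[K] L) : L →+* L) y) := by
      ext i
      simp [map_coeff, pow_succ']
    rw [e, truncate_map_congr _ ih, map_add, map_natCast, map_add, h]
    simp only [map_add, map_natCast, map_one, Nat.cast_add, Nat.cast_one]
    ring

variable [CharP L p]

/-- If `σ y = y + 1` in length `n`, then `σ ^ m` moves `y` to `y + m`, and the integer `m` vanishes in
truncated Witt vectors of length `n` only if `p ^ n ∣ m`. So the coefficients of `y` detect the order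
of `σ`. -/
theorem pow_dvd_of_pow_apply_coeff_eq {n : ℕ} {y : WittVector p L} {σ : L ≃ₐ[K] L}
    (h : truncate n (map (σ : L →+* L) y) = truncate n (y + 1)) {m : ℕ}
    (hm : ∀ i < n, (σ ^ m) (y.coeff i) = y.coeff i) : p ^ n ∣ m := by
  have h1 : truncate n (map ((σ ^ m : L ≃ₐ[K] L) : L →+* L) y) = truncate n y :=
    truncate_eq_iff.2 fun i hi => by rw [map_coeff]; exact hm i hi
  rw [truncate_map_pow h, map_add, add_eq_left] at h1
  exact pow_dvd_of_truncate_natCast_eq_zero h1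

/-- The Witt vector form of the additive Hilbert 90 for the constant cocycle `1`, whose norm
`p ^ n` vanishes in length `n`. The required element with invertible trace is the Teichmüller lift of
an element of `L` with nonzero trace. -/
theorem exists_truncate_map_eq_add_one [FiniteDimensional K L] [IsGalois K L] {n : ℕ}
    {σ : L ≃ₐ[K] L} (hσ : ∀ τ, τ ∈ Subgroup.zpowers σ) (hn : orderOf σ = p ^ n) :
    ∃ y : WittVector p L, truncate n (map (σ : L →+* L) y) = truncate n (y + 1) := by
  classical
  obtain ⟨a, ha⟩ : ∃ a : L, ∑ i ∈ Finset.range (p ^ n), (σ ^ i) a ≠ 0 := by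
    obtain ⟨a, ha⟩ := DFunLike.ne_iff.1 (Algebra.trace_ne_zero K L)
    refine ⟨a, fun h => ha ?_⟩
    apply (algebraMap K L).injective
    rw [trace_eq_sum_automorphisms, LinearMap.zero_apply, map_zero, ← h, ← hn,
      ← IsCyclic.image_range_orderOf hσ, Finset.sum_image]
    intro i hi j hj hij
    exact pow_injOn_Iio_orderOf (by simpa using hi) (by simpa using hj) hij
  have hit (i : ℕ) : (map (σ : L →+* L))^[i] (teichmuller p a) = teichmuller p ((σ ^ i) a) := by
    induction i with
    | zero => simp
    | succ i ih => rw [Function.iterate_succ_apply', ih, map_teichmuller, pow_succ']; rfl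
  obtain ⟨y, c, h⟩ := exists_map_eq_add_one (map (σ : L →+* L)) (p ^ n) (teichmuller p a)
    (by rw [hit, ← hn, pow_orderOf_eq_one]; rfl) (by
      apply isUnit_of_coeff_zero_ne_zero
      simp only [hit]
      have : (∑ i ∈ Finset.range (p ^ n), teichmuller p ((σ ^ i) a)).coeff 0 =
          ∑ i ∈ Finset.range (p ^ n), (σ ^ i) a := by
        rw [← constantCoeff_apply, map_sum]
        exact Finset.sum_congr rfl fun i _ => teichmuller_coeff_zero p _
      rwa [this])
  refine ⟨y, ?_⟩
  rw [h, map_add, Nat.cast_pow, truncate_natCast_pow_mul, add_zero]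

/-- If `σ y = y + 1` in length `n`, then `frobenius y - y` is fixed by `σ` in length `n`, hence its first
`n` coefficients lie in the base field. -/
theorem exists_algebraMap_eq_coeff_frobenius_sub [FiniteDimensional K L] [IsGalois K L] {n : ℕ}
    {σ : L ≃ₐ[K] L} (hσ : ∀ τ, τ ∈ Subgroup.zpowers σ) {y : WittVector p L}
    (h : truncate n (map (σ : L →+* L) y) = truncate n (y + 1)) {i : ℕ} (hi : i < n) :
    ∃ x : K, algebraMap K L x = (frobenius y - y).coeff i := by
  have h1 : truncate n (map (σ : L →+* L) (frobenius y - y)) = truncate n (frobenius y - y) := by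
    rw [map_sub, map_frobenius_of_charP, map_sub, truncate_frobenius_congr h, h]
    simp only [map_add, map_sub, map_one]
    ring
  have h2 := truncate_eq_iff.1 h1 i hi
  rw [map_coeff] at h2
  refine (IsGalois.mem_range_algebraMap_iff_fixed (F := K) _).2 fun τ => ?_
  have : Subgroup.zpowers σ ≤ MulAction.stabilizer (L ≃ₐ[K] L) ((frobenius y - y).coeff i) :=
    (Subgroup.zpowers_le).2 h2
  exact this (hσ τ)

/-- By Galois theory, a solution of `σ y = y + 1` in length `n` generates `L`: only the identity fixes
its first `n` coefficients. -/
theorem adjoin_coeff_eq_top [FiniteDimensional K L] [IsGalois K L] {n : ℕ}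
    {σ : L ≃ₐ[K] L} (hσ : ∀ τ, τ ∈ Subgroup.zpowers σ) (hn : orderOf σ = p ^ n)
    {y : WittVector p L}
    (h : truncate n (map (σ : L →+* L) y) = truncate n (y + 1)) (S : Subalgebra K L)
    (hS : ∀ i < n, y.coeff i ∈ S) : S = ⊤ := by
  let E : IntermediateField K L := subalgebraEquivIntermediateField S
  have hE : E.fixingSubgroup = ⊥ := by
    rw [eq_bot_iff]
    intro τ hτ
    obtain ⟨m, rfl⟩ := (mem_powers_iff_mem_zpowers.2 (hσ τ) : τ ∈ Submonoid.powers σ)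
    rw [IntermediateField.mem_fixingSubgroup_iff] at hτ
    have hd := pow_dvd_of_pow_apply_coeff_eq h fun i hi => hτ _ (hS i hi)
    exact orderOf_dvd_iff_pow_eq_one.1 (hn ▸ hd)
  have hE' : E = ⊤ := by
    rw [← IsGalois.fixedField_fixingSubgroup E, hE, IntermediateField.fixedField_bot]
  rw [eq_top_iff]
  intro a _
  have : a ∈ E := hE' ▸ IntermediateField.mem_top
  exact this

end WittVector

/-! ### Extensions defined by the Witt vector equations -/

namespace WittEquationAlgebra

variable {p : ℕ} [Fact p.Prime] {K L : Type*} [Field K] [Field L] [Algebra K L] [CharP L p]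

/-- Existence half of Artin–Schreier–Witt theory in length three. -/
theorem exists_nonempty_algEquiv [FiniteDimensional K L] [IsGalois K L]
    {σ : L ≃ₐ[K] L} (hσ : ∀ τ, τ ∈ Subgroup.zpowers σ) (hn : orderOf σ = p ^ 3) :
    ∃ x₁ x₂ x₃ : K, Nonempty (WittEquationAlgebra p x₁ x₂ x₃ ≃ₐ[K] L) := by
  obtain ⟨y, hy⟩ := WittVector.exists_truncate_map_eq_add_one hσ hn
  have hx (i : ℕ) (hi : i < 3) :=
    WittVector.exists_algebraMap_eq_coeff_frobenius_sub hσ hy hi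
  obtain ⟨x₁, h₁⟩ := hx 0 (by norm_num)
  obtain ⟨x₂, h₂⟩ := hx 1 (by norm_num)
  obtain ⟨x₃, h₃⟩ := hx 2 (by norm_num)
  have hF : WittVector.truncate 3 (WittVector.frobenius y) =
      WittVector.truncate 3 (WittVector.frobenius y - y + y) := by rw [sub_add_cancel]
  rw [WittVector.truncate_frobenius_eq_iff, ← h₁, ← h₂, ← h₃] at hF
  obtain ⟨f, hf⟩ := exists_algHom p (fun i : Fin 3 => y.coeff i) hF.1 hF.2.1 hF.2.2
  have hsurj : Function.Surjective f := by
    rw [← AlgHom.range_eq_top]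
    refine WittVector.adjoin_coeff_eq_top hσ hn hy _ fun i hi => ?_
    exact ⟨gen p x₁ x₂ x₃ ⟨i, hi⟩, hf ⟨i, hi⟩⟩
  obtain ⟨_, hle⟩ := finiteDimensional_and_finrank_le p x₁ x₂ x₃
  have hL : Module.finrank K L = p ^ 3 := by
    rw [← IsGalois.card_aut_eq_finrank, ← hn, orderOf_eq_card_of_forall_mem_zpowers hσ]
  have hfr : Module.finrank K (WittEquationAlgebra p x₁ x₂ x₃) = Module.finrank K L :=
    le_antisymm (hL ▸ hle)
      (LinearMap.finrank_le_finrank_of_surjective (f := f.toLinearMap) hsurj)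
  have hinj : Function.Injective f :=
    (LinearMap.injective_iff_surjective_of_finrank_eq_finrank (f := f.toLinearMap) hfr).2 hsurj
  exact ⟨x₁, x₂, x₃, ⟨AlgEquiv.ofBijective f ⟨hinj, hsurj⟩⟩⟩

/-- The equations say that the images of the generators are the coefficients of a Witt vector `y` with
`frobenius y = x + y` in length three. As `frobenius 1 = 1`, the coefficients of `y + 1` satisfy the same
equations, and this defines an automorphism. -/
theorem exists_algEquiv_apply_gen [Algebra.IsAlgebraic K L] {x₁ x₂ x₃ : K}
    (e : WittEquationAlgebra p x₁ x₂ x₃ ≃ₐ[K] L) :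
    ∃ (y : WittVector p L) (σ : L ≃ₐ[K] L),
      (∀ i : Fin 3, y.coeff i = e (gen p x₁ x₂ x₃ i)) ∧
      WittVector.truncate 3 (WittVector.map (σ : L →+* L) y) = WittVector.truncate 3 (y + 1) := by
  let y : WittVector p L :=
    WittVector.mk p fun n => if h : n < 3 then e (gen p x₁ x₂ x₃ ⟨n, h⟩) else 0
  let x : WittVector p L :=
    WittVector.mk p fun n => if h : n < 3 then algebraMap K L (![x₁, x₂, x₃] ⟨n, h⟩) else 0
  have hy (i : Fin 3) : y.coeff i = e (gen p x₁ x₂ x₃ i) := by simp [y]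
  have hy₁ : y.coeff 0 = e (gen p x₁ x₂ x₃ 0) := hy 0
  have hy₂ : y.coeff 1 = e (gen p x₁ x₂ x₃ 1) := hy 1
  have hy₃ : y.coeff 2 = e (gen p x₁ x₂ x₃ 2) := hy 2
  have hx₁ : x.coeff 0 = algebraMap K L x₁ := by simp [x]
  have hx₂ : x.coeff 1 = algebraMap K L x₂ := by simp [x]
  have hx₃ : x.coeff 2 = algebraMap K L x₃ := by simp [x]
  have hF : WittVector.truncate 3 (WittVector.frobenius y) = WittVector.truncate 3 (x + y) := by
    rw [WittVector.truncate_frobenius_eq_iff, hx₁, hx₂, hx₃, hy₁, hy₂, hy₃]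
    simp only [← map_pow, ← map_sub, gen_zero_pow_sub, gen_one_pow_sub, gen_two_pow_sub, map_add,
      map_wittCarry₂, map_wittCarry₃, e.commutes, and_self]
  have hF' : WittVector.truncate 3 (WittVector.frobenius (y + 1)) =
      WittVector.truncate 3 (x + (y + 1)) := by
    rw [map_add, map_add, hF, map_one, ← map_add, add_assoc]
  rw [WittVector.truncate_frobenius_eq_iff, hx₁, hx₂, hx₃] at hF'
  obtain ⟨f, hf⟩ := exists_algHom p (fun i : Fin 3 => (y + 1).coeff i) hF'.1 hF'.2.1 hF'.2.2
  let σ : L ≃ₐ[K] L := AlgEquiv.ofBijective (f.comp e.symm.toAlgHom)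
    (Algebra.IsAlgebraic.algHom_bijective _)
  refine ⟨y, σ, hy, ?_⟩
  rw [WittVector.truncate_eq_iff]
  intro i hi
  rw [WittVector.map_coeff]
  change f (e.symm (y.coeff (⟨i, hi⟩ : Fin 3))) = _
  rw [hy, e.symm_apply_apply, hf]

end WittEquationAlgebra

theorem mainTheorem7 (p : ℕ) [Fact p.Prime]
    {k : Type*} [Field k] [IsAlgClosed k] [CharP k p]
    {K : Type*} [Field K] (hK : Nonempty (K ≃+* LaurentSeries k))
    {L : Type*} [Field L] [Algebra K L] [IsGalois K L]
    (hL : Nonempty ((L ≃ₐ[K] L) ≃* Multiplicative (ZMod (p ^ 3)))) :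
    (∃ x₁ x₂ x₃ : K, Nonempty (WittEquationAlgebra p x₁ x₂ x₃ ≃ₐ[K] L)) ∧
    ∀ (x₁ x₂ x₃ : K) (e : WittEquationAlgebra p x₁ x₂ x₃ ≃ₐ[K] L) (y₁ y₂ y₃ : L),
      y₁ = e (WittEquationAlgebra.gen p x₁ x₂ x₃ 0) →
      y₂ = e (WittEquationAlgebra.gen p x₁ x₂ x₃ 1) →
      y₃ = e (WittEquationAlgebra.gen p x₁ x₂ x₃ 2) →
      ∃ σ : L ≃ₐ[K] L, (∀ τ : L ≃ₐ[K] L, τ ∈ Subgroup.zpowers σ) ∧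
        σ y₁ = y₁ + 1 ∧
        σ y₂ = y₂ + wittCarry₂ p 1 y₁ ∧
        σ y₃ = y₃ + wittCarry₃ p 1 0 y₁ y₂ := by
  obtain ⟨φ⟩ := hK
  obtain ⟨ψ⟩ := hL
  have : CharP (LaurentSeries k) p :=
    charP_of_injective_algebraMap (algebraMap k (LaurentSeries k)).injective p
  have : CharP K p := charP_of_injective_ringHom (f := φ.symm.toRingHom) φ.symm.injective p
  have : CharP L p := charP_of_injective_algebraMap (algebraMap K L).injective p
  have : NeZero (p ^ 3) := ⟨pow_ne_zero 3 (Fact.out : p.Prime).ne_zero⟩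
  have hcard : Nat.card (L ≃ₐ[K] L) = p ^ 3 := by
    rw [Nat.card_congr ψ.toEquiv, Nat.card_congr Multiplicative.toAdd, Nat.card_zmod]
  have : Finite (L ≃ₐ[K] L) := Finite.of_equiv _ ψ.symm.toEquiv
  have : FiniteDimensional K L := IsGalois.finiteDimensional_of_finite K L
  have : IsCyclic (L ≃ₐ[K] L) := isCyclic_of_surjective ψ.symm ψ.symm.surjective
  constructor
  · obtain ⟨σ, hσ⟩ := IsCyclic.exists_generator (α := L ≃ₐ[K] L)
    exact WittEquationAlgebra.exists_nonempty_algEquiv hσ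
      ((orderOf_eq_card_of_forall_mem_zpowers hσ).trans hcard)
  · rintro x₁ x₂ x₃ e _ _ _ rfl rfl rfl
    obtain ⟨y, σ, hy, hσ⟩ := WittEquationAlgebra.exists_algEquiv_apply_gen e
    have hdvd : p ^ 3 ∣ orderOf σ :=
      WittVector.pow_dvd_of_pow_apply_coeff_eq hσ fun i _ => by rw [pow_orderOf_eq_one]; rfl
    have htop : Subgroup.zpowers σ = ⊤ := by
      apply Subgroup.eq_top_of_le_card
      rw [Nat.card_zpowers, hcard]
      exact Nat.le_of_dvd (orderOf_pos σ) hdvd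
    refine ⟨σ, fun τ => htop ▸ Subgroup.mem_top τ, ?_⟩
    rw [add_comm y, WittVector.truncate_three_eq_iff] at hσ
    simp only [WittVector.map_coeff, WittVector.add_coeff_zero, WittVector.add_coeff_one_and_two,
      WittVector.one_coeff_zero, WittVector.one_coeff_eq_of_pos, zero_lt_one, zero_lt_two,
      zero_add, ← hy] at hσ ⊢
    exact ⟨hσ.1.trans (add_comm _ _), hσ.2⟩
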